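/- For $0\le \xi<\pi/3$ put $\alpha=\alpha(\xi)=e^{-i\xi}/(2\cos\xi)$, $f_1(z)=\alpha z$ and $f_2(z)=-\overline{\alpha}\,z+1$ for $z\in\mathbb{C}$. Since $1/2\le|\alpha|<1$, both maps are contractions of $\mathbb{C}$; the limit Dragon curve $\mathcal{D}(\xi)$ is the attractor of the iterated function system $\{f_1,f_2\}$, i.e. the unique nonempty compact set $K\subset\mathbb{C}$ with $K=f_1(K)\cup f_2(K)$. Its unfolding angle is $\theta=\pi-2\xi$. A simple arc is a subset of $\mathbb{C}$ homeomorphic to the segment $[0,1]$. **Theorem.** The polynomial $x^6-3x^4+2x^2-1$ has exactly one root $x_0$ in the open interval $\left(\sqrt2,\frac{1+\sqrt5}{2}\right)$, and $|x_0-1.5247|\le 5\cdot10^{-5}$. Put $\xi_0=\arccos(x_0/2)$; then $|\xi_0-0.703858|\le 5\cdot10^{-7}$. For every $\xi$ with $0\le\xi<\xi_0$, the limit Dragon curve $\mathcal{D}(\xi)$ is a simple arc. In terms of the unfolding angle, let $\theta_0=\pi-2\xi_0$, whose measure in degrees differs from $99.3438^\circ$ by at most $0.00005^\circ$. Every limit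 Dragon curve $\mathcal{D}(\xi)$, $0\le\xi<\pi/3$, whose unfolding angle $\theta$ satisfies $\theta_0<\theta\le 180^\circ$ is a simple arc. -/

import Mathlib

open Metric Topology TopologicalSpace
open scoped NNReal ENNReal

/-- `K` is an attractor of the iterated function system `{f, g}`: a nonempty compact set with
`K = f(K) ∪ g(K)`. -/
def IsAttractor {X : Type*} [TopologicalSpace X] (f g : X → X) (K : Set X) : Prop :=
  IsCompact K ∧ K.Nonempty ∧ K = f '' K ∪ g '' K

/-- A Lipschitz map is Lipschitz for the Hausdorff distance on compact sets. -/
theorem hausdorffEDist_image_le {X : Type*} [MetricSpace X] {f : X → X} {c : ℝ≥0}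
    (hf : LipschitzWith c f) {A B : Set X} (hA : IsCompact A) (hA' : A.Nonempty)
    (hB : IsCompact B) (hB' : B.Nonempty) :
    hausdorffEDist (f '' A) (f '' B) ≤ c * hausdorffEDist A B := by
  apply hausdorffEDist_le_of_mem_edist
  · rintro _ ⟨x, hx, rfl⟩
    obtain ⟨y, hy, hxy⟩ := hB.exists_infEDist_eq_edist hB' x
    refine ⟨f y, ⟨y, hy, rfl⟩, (hf x y).trans ?_⟩
    gcongr
    exact hxy ▸ infEDist_le_hausdorffEDist_of_mem hx
  · rintro _ ⟨x, hx, rfl⟩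
    obtain ⟨y, hy, hxy⟩ := hA.exists_infEDist_eq_edist hA' x
    refine ⟨f y, ⟨y, hy, rfl⟩, (hf x y).trans ?_⟩
    gcongr
    rw [hausdorffEDist_comm]
    exact hxy ▸ infEDist_le_hausdorffEDist_of_mem hx

/-- Two contractions of a nonempty complete metric space have exactly one attractor. -/
theorem existsUnique_isAttractor {X : Type*} [MetricSpace X] [CompleteSpace X] [Nonempty X]
    {f g : X → X} {c : ℝ≥0} (hc : c < 1) (hf : LipschitzWith c f) (hg : LipschitzWith c g) :
    ∃! K : Set X, IsAttractor f g K := by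
  let F : NonemptyCompacts X → NonemptyCompacts X := fun K =>
    ⟨⟨f '' K ∪ g '' K, (K.isCompact.image hf.continuous).union (K.isCompact.image hg.continuous)⟩,
      (K.nonempty.image f).inl⟩
  have hF : ContractingWith c F := by
    refine ⟨hc, fun A B => ?_⟩
    refine (hausdorffEDist_union_le).trans (max_le ?_ ?_)
    · exact hausdorffEDist_image_le hf A.isCompact A.nonempty B.isCompact B.nonempty
    · exact hausdorffEDist_image_le hg A.isCompact A.nonempty B.isCompact B.nonempty
  obtain ⟨x₀⟩ := ‹Nonempty X›
  have : Nonempty (NonemptyCompacts X) := ⟨{x₀}⟩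
  refine ⟨(hF.fixedPoint F : NonemptyCompacts X),
    ⟨NonemptyCompacts.isCompact _, NonemptyCompacts.nonempty _, ?_⟩, ?_⟩
  · exact congrArg (fun K : NonemptyCompacts X => (K : Set X)) hF.fixedPoint_isFixedPt.symm
  · rintro K ⟨h1, h2, h3⟩
    let K' : NonemptyCompacts X := ⟨⟨K, h1⟩, h2⟩
    have : K' = hF.fixedPoint F := hF.fixedPoint_unique (NonemptyCompacts.ext h3.symm)
    exact congrArg (fun K : NonemptyCompacts X => (K : Set X)) this

noncomputable section

namespace Dragon

/-- `α = e^{-iξ} / (2 cos ξ)`. -/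
def alpha (ξ : ℝ) : ℂ := Complex.exp (-(ξ : ℂ) * Complex.I) / (2 * Real.cos ξ : ℝ)

/-- `f₁(z) = α z`. -/
def f₁ (ξ : ℝ) (z : ℂ) : ℂ := alpha ξ * z

/-- `f₂(z) = -ᾱ z + 1`. -/
def f₂ (ξ : ℝ) (z : ℂ) : ℂ := -(starRingEnd ℂ (alpha ξ)) * z + 1

open Classical in
/-- The limit Dragon curve `𝒟(ξ)`: the attractor of the iterated function system `{f₁, f₂}`.
For `0 ≤ ξ < π/3` both maps are contractions and the attractor exists and is unique, see
`isAttractor_limitDragon` and `eq_limitDragon`. -/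
def limitDragon (ξ : ℝ) : Set ℂ :=
  if h : ∃ K : Set ℂ, IsAttractor (f₁ ξ) (f₂ ξ) K then h.choose else ∅

theorem norm_alpha (ξ : ℝ) : ‖alpha ξ‖ = 1 / |2 * Real.cos ξ| := by
  have h : -(ξ : ℂ) * Complex.I = ((-ξ : ℝ) : ℂ) * Complex.I := by push_cast; ring
  rw [alpha, norm_div, h, Complex.norm_exp_ofReal_mul_I, Complex.norm_real, Real.norm_eq_abs]

theorem norm_alpha_lt_one {ξ : ℝ} (h0 : 0 ≤ ξ) (h1 : ξ < Real.pi / 3) : ‖alpha ξ‖ < 1 := by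
  have h : 1 / 2 < Real.cos ξ := by
    rw [← Real.cos_pi_div_three]
    exact Real.cos_lt_cos_of_nonneg_of_le_pi h0 (by linarith [Real.pi_pos]) h1
  rw [norm_alpha, abs_of_pos (by linarith), div_lt_one (by linarith)]
  linarith

theorem existsUnique_limitDragon {ξ : ℝ} (h0 : 0 ≤ ξ) (h1 : ξ < Real.pi / 3) :
    ∃! K : Set ℂ, IsAttractor (f₁ ξ) (f₂ ξ) K := by
  refine existsUnique_isAttractor (c := ‖alpha ξ‖₊) (by exact_mod_cast norm_alpha_lt_one h0 h1)
    (LipschitzWith.of_dist_le_mul fun z w => ?_) (LipschitzWith.of_dist_le_mul fun z w => ?_)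
  · simp [f₁, dist_eq_norm, ← mul_sub]
  · have h : f₂ ξ z - f₂ ξ w = -(starRingEnd ℂ (alpha ξ)) * (z - w) := by
      simp only [f₂]; ring
    rw [dist_eq_norm, dist_eq_norm, h, norm_mul, norm_neg, RCLike.norm_conj, coe_nnnorm]

theorem isAttractor_limitDragon {ξ : ℝ} (h0 : 0 ≤ ξ) (h1 : ξ < Real.pi / 3) :
    IsAttractor (f₁ ξ) (f₂ ξ) (limitDragon ξ) := by
  have h := (existsUnique_limitDragon h0 h1).exists
  rw [limitDragon, dif_pos h]
  exact h.choose_spec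

theorem eq_limitDragon {ξ : ℝ} (h0 : 0 ≤ ξ) (h1 : ξ < Real.pi / 3) {K : Set ℂ}
    (hK : IsAttractor (f₁ ξ) (f₂ ξ) K) : K = limitDragon ξ :=
  (existsUnique_limitDragon h0 h1).unique hK (isAttractor_limitDragon h0 h1)

/-- The unfolding angle `θ = π - 2ξ` of `𝒟(ξ)`, in radians. -/
def unfoldingAngle (ξ : ℝ) : ℝ := Real.pi - 2 * ξ

/-- The measure in degrees of an angle given in radians. -/
def degrees (t : ℝ) : ℝ := t * 180 / Real.pi

end Dragon

/-- A simple arc: a subset of the plane homeomorphic to the segment `[0, 1]`. -/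
def IsSimpleArc (S : Set ℂ) : Prop := Nonempty (S ≃ₜ Set.Icc (0 : ℝ) 1)

end

/-! Since `α = (1 - i t) / 2` with `t = tan ξ`, everything depends on the slope `t` alone. The map
`f₁` fixes `0`, `f₂` sends `0` to `1`, and both send `1` to `α`. On `[0, 1]` the maps `x / 2` and `1
- x / 2` follow the same pattern. If the two halves of the attractor meet only in `α`, nothing else
distinguishes the two systems: the attractor of the product system is the graph of a homeomorphism
between the attractors (`IsZipper.nonempty_homeomorph`).

That the halves meet only in `α` has a finite and a self-similar part. Four pairs of subpieces are
shown disjoint by enclosing pieces in discs and subdividing, in exact rational arithmetic, for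
twelve slope intervals covering `[0, 0.86]` (`isGood_of_mem_discs`). The one remaining pair contains
`α`; its coincidences reproduce themselves under scaling by `α`, so by compactness there is only one
(`eq_zero_of_word_eq`).

Every `ξ < ξ₀` has `tan ξ ≤ 0.86`. The polynomial enters only through the numerical value of its
root. -/

/-! ### Zippers and homeomorphisms of their attractors -/

/-- Two injective contractions `f`, `g` that map the segment from `p` to `q` to segments from `p` to
`f q` and from `q` to `f q`, and whose attractor `K` satisfies `f(K) ∩ g(K) = {f q}`. -/
structure IsZipper {X : Type*} [MetricSpace X] (f g : X → X) (c : ℝ≥0) (p q : X) (K : Set X) :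
    Prop where
  lt_one : c < 1
  lip_left : LipschitzWith c f
  lip_right : LipschitzWith c g
  inj_left : Function.Injective f
  inj_right : Function.Injective g
  ne : p ≠ q
  left_fixed : f p = p
  right_apply : g p = q
  join : f q = g q
  attractor : IsAttractor f g K
  eq_of_eq : ∀ x ∈ K, ∀ y ∈ K, f x = g y → x = q ∧ y = q

theorem IsAttractor.left_mem {X : Type*} [TopologicalSpace X] {f g : X → X} {K : Set X}
    (h : IsAttractor f g K) {x : X} (hx : x ∈ K) : f x ∈ K := by
  rw [h.2.2]; exact Or.inl ⟨x, hx, rfl⟩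

theorem IsAttractor.right_mem {X : Type*} [TopologicalSpace X] {f g : X → X} {K : Set X}
    (h : IsAttractor f g K) {x : X} (hx : x ∈ K) : g x ∈ K := by
  rw [h.2.2]; exact Or.inr ⟨x, hx, rfl⟩

theorem IsAttractor.exists_of_mem {X : Type*} [TopologicalSpace X] {f g : X → X} {K : Set X}
    (h : IsAttractor f g K) {x : X} (hx : x ∈ K) :
    (∃ y ∈ K, f y = x) ∨ ∃ y ∈ K, g y = x := by
  rw [h.2.2] at hx; exact hx

theorem le_zero_of_le_mul_self {c : ℝ≥0} (hc : c < 1) {d : ℝ} (h : d ≤ c * d) : d ≤ 0 := by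
  have : (c : ℝ) < 1 := by exact_mod_cast hc
  nlinarith

/-- A contraction that maps a nonempty compact set to itself has its fixed point there. -/
theorem mem_of_fixed {X : Type*} [MetricSpace X] {f : X → X} {c : ℝ≥0} (hc : c < 1)
    (hf : LipschitzWith c f) {K : Set X} (hK : IsCompact K) (hne : K.Nonempty)
    (hfK : ∀ x ∈ K, f x ∈ K) {p : X} (hp : f p = p) : p ∈ K := by
  obtain ⟨x, hx, hmin⟩ := hK.exists_isMinOn hne (continuous_id.dist continuous_const :
    Continuous fun x => dist x p).continuousOn
  have h1 : dist x p ≤ dist (f x) p := hmin (hfK x hx)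
  have h2 : dist (f x) p ≤ c * dist x p := by
    conv_lhs => rw [← hp]
    exact hf.dist_le_mul x p
  have h3 := le_zero_of_le_mul_self hc (h1.trans h2)
  rwa [← dist_le_zero.1 h3]

/-- A nonempty compact set all of whose points are images of points of the set under a
contraction fixing `p` is `{p}`. -/
theorem eq_fixed_of_mem {X : Type*} [MetricSpace X] {f : X → X} {c : ℝ≥0} (hc : c < 1)
    (hf : LipschitzWith c f) {K : Set X} (hK : IsCompact K)
    (hfK : ∀ x ∈ K, ∃ y ∈ K, f y = x) {p : X} (hp : f p = p) : ∀ x ∈ K, x = p := by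
  intro z hz
  obtain ⟨x, hx, hmax⟩ := hK.exists_isMaxOn ⟨z, hz⟩ (continuous_id.dist continuous_const :
    Continuous fun x => dist x p).continuousOn
  obtain ⟨y, hy, rfl⟩ := hfK x hx
  have h1 : dist y p ≤ dist (f y) p := hmax hy
  have h2 : dist (f y) p ≤ c * dist y p := by
    conv_lhs => rw [← hp]
    exact hf.dist_le_mul y p
  have h4 : dist (f y) p ≤ 0 :=
    le_zero_of_le_mul_self hc (h2.trans (mul_le_mul_of_nonneg_left h1 c.2))
  have h3 : dist z p ≤ dist (f y) p := hmax hz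
  exact dist_le_zero.1 (h3.trans h4)

theorem lipschitzWith_prodMap {X Y : Type*} [MetricSpace X] [MetricSpace Y] {f : X → X}
    {g : Y → Y} {c d : ℝ≥0} (hf : LipschitzWith c f) (hg : LipschitzWith d g) :
    LipschitzWith (max c d) (Prod.map f g) := by
  intro x y
  refine max_le ((hf x.1 y.1).trans ?_) ((hg x.2 y.2).trans ?_)
  · gcongr
    exacts [le_max_left c d, le_max_left _ _]
  · gcongr
    exacts [le_max_right c d, le_max_right _ _]

namespace IsZipper

variable {X Y : Type*} [MetricSpace X] [MetricSpace Y] {f g : X → X} {f' g' : Y → Y}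
  {c c' : ℝ≥0} {p q : X} {p' q' : Y} {K : Set X} {K' : Set Y}

theorem start_mem (h : IsZipper f g c p q K) : p ∈ K :=
  mem_of_fixed h.lt_one h.lip_left h.attractor.1 h.attractor.2.1
    (fun _ => h.attractor.left_mem) h.left_fixed

theorem swap_product {L : Set (X × Y)} (hL : IsAttractor (Prod.map f f') (Prod.map g g') L) :
    IsAttractor (Prod.map f' f) (Prod.map g' g) (Prod.swap '' L) := by
  refine ⟨hL.1.image continuous_swap, hL.2.1.image _, ?_⟩
  conv_lhs => rw [hL.2.2]
  rw [Set.image_union, Set.image_image, Set.image_image, Set.image_image, Set.image_image]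
  rfl

theorem image_fst {L : Set (X × Y)} (hL : IsAttractor (Prod.map f f') (Prod.map g g') L) :
    IsAttractor f g (Prod.fst '' L) := by
  refine ⟨hL.1.image continuous_fst, hL.2.1.image _, ?_⟩
  conv_lhs => rw [hL.2.2]
  rw [Set.image_union, Set.image_image, Set.image_image, Set.image_image, Set.image_image]
  rfl

/-- The attractor of the product of two zippers is a graph over the first factor. -/
theorem injOn_fst (h : IsZipper f g c p q K) (h' : IsZipper f' g' c' p' q' K') {L : Set (X × Y)}
    (hL : IsAttractor (Prod.map f f') (Prod.map g g') L) (hLK : ∀ z ∈ L, z.1 ∈ K) :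
    Set.InjOn Prod.fst L := by
  have hp := h.start_mem
  have hq : q ∈ K := h.right_apply ▸ h.attractor.right_mem hp
  -- The point `p` is not in `g(K)`, so each point of `L` over `p` comes from another one under `(f,
  -- f')`: the fibre is covered by its own `f'`-image.
  have hfix : ∀ y, (p, y) ∈ L → y = p' := by
    have hc : IsCompact {y | (p, y) ∈ L} := by
      have : IsCompact (Prod.snd '' (L ∩ {z | z.1 = p})) :=
        (hL.1.inter_right (isClosed_eq continuous_fst continuous_const)).image continuous_snd
      convert this using 1
      ext y
      constructor
      · exact fun hy => ⟨(p, y), ⟨hy, rfl⟩, rfl⟩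
      · rintro ⟨⟨x, y⟩, ⟨hz, hx⟩, rfl⟩
        simpa [← show x = p from hx] using hz
    refine eq_fixed_of_mem h'.lt_one h'.lip_left hc (fun y hy => ?_) h'.left_fixed
    rcases hL.exists_of_mem hy with ⟨⟨x, w⟩, hz, he⟩ | ⟨⟨x, w⟩, hz, he⟩
    · obtain ⟨e1, e2⟩ := Prod.mk.inj he
      have : x = p := h.inj_left (e1.trans h.left_fixed.symm)
      exact ⟨w, this ▸ hz, e2⟩
    · obtain ⟨e1, e2⟩ := Prod.mk.inj he
      exact absurd (h.eq_of_eq p hp x (hLK _ hz) (h.left_fixed.trans e1.symm)).1 h.ne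
  -- As `q = g p` is not in `f(K)`, the fibre over `q` is the `g'`-image of the fibre over `p`.
  have hend : ∀ y, (q, y) ∈ L → y = q' := by
    intro y hy
    rcases hL.exists_of_mem hy with ⟨⟨x, w⟩, hz, he⟩ | ⟨⟨x, w⟩, hz, he⟩
    · obtain ⟨e1, e2⟩ := Prod.mk.inj he
      exact absurd (h.eq_of_eq x (hLK _ hz) p hp (e1.trans h.right_apply.symm)).2 h.ne
    · obtain ⟨e1, e2⟩ := Prod.mk.inj he
      have : x = p := h.inj_right (e1.trans h.right_apply.symm)
      rw [← e2, hfix w (this ▸ hz), h'.right_apply]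
  have hS : IsCompact {z : (X × Y) × (X × Y) | (z.1 ∈ L ∧ z.2 ∈ L) ∧ z.1.1 = z.2.1} :=
    (hL.1.prod hL.1).inter_right (isClosed_eq (by fun_prop) (by fun_prop))
  rintro ⟨x, y⟩ hz ⟨x', y'⟩ hz' (rfl : x = x')
  -- Take two points in a common fibre at maximal distance. If both come from the same branch, their
  -- preimages also share a fibre and contraction forces distance zero; if from different branches,
  -- both preimages lie over `q`, where the fibre is `{q'}`, and `join` identifies their images.
  obtain ⟨⟨⟨u, v⟩, ⟨u', v'⟩⟩, ⟨⟨hu, hu'⟩, (rfl : u = u')⟩, hmax⟩ := hS.exists_isMaxOn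
    ⟨((x, y), (x, y')), ⟨hz, hz'⟩, rfl⟩
    (by fun_prop : Continuous fun z : (X × Y) × (X × Y) => dist z.1.2 z.2.2).continuousOn
  have hle : dist y y' ≤ dist v v' := hmax (a := ((x, y), (x, y'))) ⟨⟨hz, hz'⟩, rfl⟩
  have key : v = v' := by
    rcases hL.exists_of_mem hu with ⟨⟨a, b⟩, hab, he⟩ | ⟨⟨a, b⟩, hab, he⟩ <;>
    rcases hL.exists_of_mem hu' with ⟨⟨a', b'⟩, hab', he'⟩ | ⟨⟨a', b'⟩, hab', he'⟩ <;>
    obtain ⟨e1, e2⟩ := Prod.mk.inj he <;>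
    obtain ⟨e1', e2'⟩ := Prod.mk.inj he'
    · obtain rfl : a = a' := h.inj_left (e1.trans e1'.symm)
      have h1 : dist b b' ≤ dist v v' := hmax (a := ((a, b), (a, b'))) ⟨⟨hab, hab'⟩, rfl⟩
      have h2 : dist v v' ≤ c' * dist b b' := by
        rw [← e2, ← e2']; exact h'.lip_left.dist_le_mul _ _
      exact dist_le_zero.1 (le_zero_of_le_mul_self h'.lt_one
        (h2.trans (mul_le_mul_of_nonneg_left h1 c'.2)))
    · obtain ⟨rfl, rfl⟩ := h.eq_of_eq _ (hLK _ hab) _ (hLK _ hab') (e1.trans e1'.symm)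
      rw [← e2, ← e2', hend b hab, hend b' hab', h'.join]
    · obtain ⟨rfl, rfl⟩ := h.eq_of_eq _ (hLK _ hab') _ (hLK _ hab) (e1'.trans e1.symm)
      rw [← e2, ← e2', hend b hab, hend b' hab', h'.join]
    · obtain rfl : a = a' := h.inj_right (e1.trans e1'.symm)
      have h1 : dist b b' ≤ dist v v' := hmax (a := ((a, b), (a, b'))) ⟨⟨hab, hab'⟩, rfl⟩
      have h2 : dist v v' ≤ c' * dist b b' := by
        rw [← e2, ← e2']; exact h'.lip_right.dist_le_mul _ _
      exact dist_le_zero.1 (le_zero_of_le_mul_self h'.lt_one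
        (h2.trans (mul_le_mul_of_nonneg_left h1 c'.2)))
  rw [key, dist_self] at hle
  rw [dist_le_zero.1 hle]

/-- The attractors of two zippers are homeomorphic. -/
theorem nonempty_homeomorph [CompleteSpace X] [CompleteSpace Y]
    (h : IsZipper f g c p q K) (h' : IsZipper f' g' c' p' q' K') : Nonempty (K ≃ₜ K') := by
  have : Nonempty (X × Y) := ⟨(p, p')⟩
  have : Nonempty X := ⟨p⟩
  have : Nonempty Y := ⟨p'⟩
  obtain ⟨L, hL, -⟩ := existsUnique_isAttractor (X := X × Y) (f := Prod.map f f')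
    (g := Prod.map g g') (c := max c c') (max_lt h.lt_one h'.lt_one)
    (lipschitzWith_prodMap h.lip_left h'.lip_left) (lipschitzWith_prodMap h.lip_right h'.lip_right)
  have hL' := swap_product hL
  have e1 : Prod.fst '' L = K :=
    (existsUnique_isAttractor h.lt_one h.lip_left h.lip_right).unique (image_fst hL) h.attractor
  have e2 : Prod.fst '' (Prod.swap '' L) = K' :=
    (existsUnique_isAttractor h'.lt_one h'.lip_left h'.lip_right).unique (image_fst hL')
      h'.attractor
  have i1 := h.injOn_fst h' hL fun z hz => e1 ▸ ⟨z, hz, rfl⟩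
  have i2 := h'.injOn_fst h hL' fun z hz => e2 ▸ ⟨z, hz, rfl⟩
  have e3 : Prod.snd '' L = K' := by rw [← e2, Set.image_image]; rfl
  have i3 : Set.InjOn Prod.snd L := fun z hz w hw hzw =>
    Prod.swap_injective (i2 ⟨z, hz, rfl⟩ ⟨w, hw, rfl⟩ hzw)
  have : CompactSpace L := isCompact_iff_compactSpace.1 hL.1
  have b1 : Set.BijOn Prod.fst L K := ⟨fun z hz => e1 ▸ ⟨z, hz, rfl⟩, i1, e1.symm.subset⟩
  have b3 : Set.BijOn Prod.snd L K' := ⟨fun z hz => e3 ▸ ⟨z, hz, rfl⟩, i3, e3.symm.subset⟩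
  let φ : L ≃ₜ K := Continuous.homeoOfEquivCompactToT2 (f := b1.equiv)
    (Continuous.subtype_mk (continuous_fst.comp continuous_subtype_val) _)
  let ψ : L ≃ₜ K' := Continuous.homeoOfEquivCompactToT2 (f := b3.equiv)
    (Continuous.subtype_mk (continuous_snd.comp continuous_subtype_val) _)
  exact ⟨φ.symm.trans ψ⟩

end IsZipper

/-- The second map reverses the segment, matching `f₂`, which sends `0` to `1` and `1` to the common
point of the halves. -/
theorem isZipper_Icc : IsZipper (fun x : ℝ => x / 2) (fun x : ℝ => 1 - x / 2) (1 / 2) 0 1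
    (Set.Icc 0 1) where
  lt_one := by rw [← NNReal.coe_lt_coe]; norm_num
  lip_left := LipschitzWith.of_dist_le_mul fun x y => by
    rw [Real.dist_eq, Real.dist_eq, ← sub_div, abs_div]; norm_num; linarith
  lip_right := LipschitzWith.of_dist_le_mul fun x y => by
    rw [Real.dist_eq, Real.dist_eq, show 1 - x / 2 - (1 - y / 2) = -((x - y) / 2) by ring, abs_neg,
      abs_div]
    norm_num; linarith
  inj_left := fun x y h => by simp only at h; linarith
  inj_right := fun x y h => by simp only at h; linarith
  ne := zero_ne_one
  left_fixed := by norm_num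
  right_apply := by norm_num
  join := by norm_num
  attractor := by
    refine ⟨isCompact_Icc, ⟨0, by norm_num⟩, ?_⟩
    ext x
    constructor
    · rintro ⟨h0, h1⟩
      rcases le_total x (1 / 2) with h | h
      · exact Or.inl ⟨2 * x, ⟨by linarith, by linarith⟩, by simp⟩
      · exact Or.inr ⟨2 - 2 * x, ⟨by linarith, by linarith⟩, by ring⟩
    · rintro (⟨y, ⟨h0, h1⟩, rfl⟩ | ⟨y, ⟨h0, h1⟩, rfl⟩)
      · exact ⟨by linarith, by linarith⟩
      · exact ⟨by linarith, by linarith⟩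
  eq_of_eq := by
    rintro x ⟨h0, h1⟩ y ⟨h2, h3⟩ h
    have h : x / 2 = 1 - y / 2 := h
    exact ⟨by linarith, by linarith⟩

/-! ### Numerical values of the root and of the critical angle -/

/-- The Taylor polynomial of degree `10` of the cosine. -/
theorem abs_cos_sub_taylor_le {x : ℝ} (hx : |x| ≤ 1) :
    |Real.cos x - (1 - x ^ 2 / 2 + x ^ 4 / 24 - x ^ 6 / 720 + x ^ 8 / 40320 - x ^ 10 / 3628800)|
      ≤ |x| ^ 12 * (13 / (479001600 * 12)) := by
  have hx' : ‖(x : ℂ) * Complex.I‖ = |x| := by simp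
  have h := Complex.exp_bound (x := (x : ℂ) * Complex.I) (by rw [hx']; exact hx)
    (n := 12) (by norm_num)
  have h2 := (Complex.abs_re_le_norm _).trans h
  rw [hx', Complex.sub_re, Complex.exp_ofReal_mul_I_re] at h2
  have hI : ∀ n : ℕ, ((x : ℂ) * Complex.I) ^ n = ((x ^ n : ℝ) : ℂ) * Complex.I ^ n := by
    intro n; push_cast; ring
  have hs : (∑ m ∈ Finset.range 12, ((x : ℂ) * Complex.I) ^ m / (m.factorial : ℂ)).re =
      1 - x ^ 2 / 2 + x ^ 4 / 24 - x ^ 6 / 720 + x ^ 8 / 40320 - x ^ 10 / 3628800 := by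
    have hd : ∀ n : ℕ, ((x : ℂ) * Complex.I) ^ n / (n.factorial : ℂ) =
        ((x ^ n / n.factorial : ℝ) : ℂ) * Complex.I ^ n := by
      intro n; push_cast; ring
    simp only [hd, Complex.re_sum, Complex.re_ofReal_mul]
    simp only [Finset.sum_range_succ, Finset.sum_range_zero, Nat.factorial]
    norm_num [pow_succ, Complex.I_mul_I]
    ring
  rw [hs] at h2
  refine h2.trans (le_of_eq ?_)
  norm_num [Nat.factorial]

/-- Sign change gives existence. For uniqueness, in `u = x²` the polynomial is a cubic that
increases for `u > 2`; the upper end of the interval is not needed there. -/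
theorem existsUnique_root : ∃ x₀ : ℝ, (1.52470256 ≤ x₀ ∧ x₀ ≤ 1.5247026) ∧
    ∀ x : ℝ, (Real.sqrt 2 < x ∧ x < (1 + Real.sqrt 5) / 2 ∧
      x ^ 6 - 3 * x ^ 4 + 2 * x ^ 2 - 1 = 0) ↔ x = x₀ := by
  obtain ⟨x₀, ⟨h1, h2⟩, h3⟩ := intermediate_value_Icc (a := (1.52470256 : ℝ)) (b := 1.5247026)
    (f := fun x => x ^ 6 - 3 * x ^ 4 + 2 * x ^ 2 - 1) (by norm_num) (by fun_prop)
    (show (0 : ℝ) ∈ _ by constructor <;> norm_num)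
  refine ⟨x₀, ⟨h1, h2⟩, fun x => ⟨?_, ?_⟩⟩
  · rintro ⟨hx1, -, hx3⟩
    have hx2 : 2 < x ^ 2 := (Real.sqrt_lt' (by linarith [Real.sqrt_nonneg 2])).1 hx1
    have hx0 : 0 < x := lt_of_le_of_lt (Real.sqrt_nonneg 2) hx1
    have h4 : 2 < x₀ ^ 2 := by nlinarith
    have h5 : (x ^ 2 - x₀ ^ 2) * ((x ^ 2) ^ 2 + x ^ 2 * x₀ ^ 2 + (x₀ ^ 2) ^ 2
        - 3 * (x ^ 2 + x₀ ^ 2) + 2) = 0 := by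
      simp only at h3
      linear_combination hx3 - h3
    rcases mul_eq_zero.1 h5 with h6 | h6
    · exact (sq_eq_sq₀ hx0.le (by linarith)).1 (sub_eq_zero.1 h6)
    · nlinarith [mul_pos (sub_pos.2 hx2) (sub_pos.2 h4)]
  · rintro rfl
    refine ⟨?_, ?_, h3⟩
    · rw [Real.sqrt_lt' (by linarith)]; nlinarith
    · have : (2.2 : ℝ) < Real.sqrt 5 := Real.lt_sqrt_of_sq_lt (by norm_num)
      linarith

theorem arccos_bounds {x : ℝ} (h1 : 1.52470256 ≤ x) (h2 : x ≤ 1.5247026) :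
    0.7038577 ≤ Real.arccos (x / 2) ∧ Real.arccos (x / 2) ≤ 0.70385774 := by
  have hpi := Real.pi_gt_three
  have ha := abs_le.1 (abs_cos_sub_taylor_le (x := 0.7038577) (by norm_num [abs_of_pos]))
  have hb := abs_le.1 (abs_cos_sub_taylor_le (x := 0.70385774) (by norm_num [abs_of_pos]))
  rw [abs_of_pos (by norm_num)] at ha hb
  norm_num at ha hb
  constructor
  · rw [← Real.arccos_cos (x := 0.7038577) (by norm_num) (by linarith)]
    apply Real.arccos_le_arccos
    norm_num at h2 ⊢
    linarith [ha.1]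
  · rw [← Real.arccos_cos (x := 0.70385774) (by norm_num) (by linarith)]
    apply Real.arccos_le_arccos
    norm_num at h1 ⊢
    linarith [hb.2]

/-! ### Words in the two maps and enclosing discs -/

noncomputable section

namespace Dragon

/-- The two maps `z ↦ a z` (`false`) and `z ↦ -ā z + 1` (`true`). -/
def letter (a : ℂ) : Bool → ℂ → ℂ
  | false, z => a * z
  | true, z => -(starRingEnd ℂ a) * z + 1

/-- The composition of the maps `letter a b` along a word. -/
def word (a : ℂ) (u : List Bool) (z : ℂ) : ℂ := u.foldr (letter a) z

theorem letter_sub (a : ℂ) (b : Bool) (z w : ℂ) :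
    letter a b z - letter a b w = (bif b then -(starRingEnd ℂ a) else a) * (z - w) := by
  cases b <;> simp [letter] <;> ring

theorem norm_letter_sub (a : ℂ) (b : Bool) (z w : ℂ) :
    ‖letter a b z - letter a b w‖ = ‖a‖ * ‖z - w‖ := by
  rw [letter_sub, norm_mul]; cases b <;> simp

theorem norm_letter_sub_param (a a' : ℂ) (b : Bool) (z : ℂ) :
    ‖letter a b z - letter a' b z‖ = ‖a - a'‖ * ‖z‖ := by
  cases b
  · simp [letter, ← sub_mul]
  · have : letter a true z - letter a' true z = -(starRingEnd ℂ (a - a')) * z := by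
      simp [letter]; ring
    rw [this, norm_mul, norm_neg, RCLike.norm_conj]

theorem letter_mem {a : ℂ} {K : Set ℂ} (hK : IsAttractor (letter a false) (letter a true) K)
    (b : Bool) {z : ℂ} (hz : z ∈ K) : letter a b z ∈ K := by
  cases b
  exacts [hK.left_mem hz, hK.right_mem hz]

theorem exists_letter {a : ℂ} {K : Set ℂ} (hK : IsAttractor (letter a false) (letter a true) K)
    {z : ℂ} (hz : z ∈ K) : ∃ b, ∃ w ∈ K, letter a b w = z :=
  (hK.exists_of_mem hz).elim (fun h => ⟨_, h⟩) fun h => ⟨_, h⟩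

theorem word_mem {a : ℂ} {K : Set ℂ} (hK : IsAttractor (letter a false) (letter a true) K)
    (u : List Bool) {z : ℂ} (hz : z ∈ K) : word a u z ∈ K := by
  induction u with
  | nil => exact hz
  | cons b u ih => exact letter_mem hK b ih

theorem word_append_letter (a : ℂ) (u : List Bool) (b : Bool) (z : ℂ) :
    word a (u ++ [b]) z = word a u (letter a b z) := by
  simp [word]

/-- An invariant disc contains the attractor. -/
theorem norm_sub_le_of_mem {a : ℂ} {K : Set ℂ} {ρ r : ℝ} {c : ℂ}
    (hK : IsAttractor (letter a false) (letter a true) K) (ha : ‖a‖ ≤ ρ) (hρ : ρ < 1)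
    (h : ∀ b, ‖letter a b c - c‖ ≤ (1 - ρ) * r) {z : ℂ} (hz : z ∈ K) : ‖z - c‖ ≤ r := by
  obtain ⟨w, hw, hmax⟩ := hK.1.exists_isMaxOn hK.2.1
    (by fun_prop : Continuous fun z : ℂ => ‖z - c‖).continuousOn
  obtain ⟨b, y, hy, hyw⟩ := exists_letter hK hw
  have h1 : ‖y - c‖ ≤ ‖w - c‖ := hmax hy
  have h2 : ‖w - c‖ ≤ ‖letter a b y - letter a b c‖ + ‖letter a b c - c‖ := by
    rw [← hyw]
    exact norm_sub_le_norm_sub_add_norm_sub _ _ _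
  rw [norm_letter_sub] at h2
  have h3 : ‖a‖ * ‖y - c‖ ≤ ρ * ‖w - c‖ := by
    have := (norm_nonneg a).trans ha
    gcongr
  have h4 : ‖z - c‖ ≤ ‖w - c‖ := hmax hz
  have h5 := h b
  nlinarith

/-- Parameters of a disc with centre `x + i y` and radius `r` that contains the attractor for all
slopes at distance at most `δ` from `t`. -/
structure DiscData where
  /-- the slope in the middle -/
  t : ℚ
  /-- the maximal distance of the slope from `t` -/
  δ : ℚ
  /-- the real part of the centre -/
  x : ℚ
  /-- the imaginary part of the centre -/
  y : ℚ
  /-- a bound of the absolute value of the centre -/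
  m : ℚ
  /-- a bound of the contraction ratio -/
  ρ : ℚ
  /-- the radius -/
  r : ℚ

/-- The maps `letter` for the multiplier `(1 - i t) / 2`, on rational points. -/
def ratLetter (t : ℚ) : Bool → ℚ × ℚ → ℚ × ℚ
  | false, p => (p.1 / 2 + t * p.2 / 2, p.2 / 2 - t * p.1 / 2)
  | true, p => (1 - p.1 / 2 + t * p.2 / 2, -(p.2 / 2 + t * p.1 / 2))

/-- The squared Euclidean distance. -/
def sqDist (p q : ℚ × ℚ) : ℚ := (p.1 - q.1) * (p.1 - q.1) + (p.2 - q.2) * (p.2 - q.2)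

namespace DiscData

/-- The centre of the disc of a word. -/
def centre (D : DiscData) (u : List Bool) : ℚ × ℚ := u.foldr (ratLetter D.t) (D.x, D.y)

/-- The radius of the discs of the words of a given length. -/
def radius (D : DiscData) : ℕ → ℚ
  | 0 => D.r
  | n + 1 => D.ρ * D.radius n + D.δ / 2 * (D.m + D.r)

/-- The disc is invariant. -/
def isValid (D : DiscData) : Bool :=
  -- The multiplier moves by at most `δ / 2`, hence the image of the centre by at most `δ / 2 * m`;
  -- this is reserved so that one test at slope `t` serves the whole interval.
  let e := (1 - D.ρ) * D.r - D.δ / 2 * D.m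
  decide (0 ≤ D.t) && decide (0 ≤ D.δ) && decide (0 ≤ D.ρ) && decide (D.ρ < 1) &&
  decide (0 ≤ D.r) && decide ((D.t + D.δ) * (D.t + D.δ) + 1 ≤ 4 * (D.ρ * D.ρ)) &&
  decide (0 ≤ D.m) && decide (D.x * D.x + D.y * D.y ≤ D.m * D.m) && decide (0 ≤ e) &&
  decide (sqDist (ratLetter D.t false (D.x, D.y)) (D.x, D.y) ≤ e * e) &&
  decide (sqDist (ratLetter D.t true (D.x, D.y)) (D.x, D.y) ≤ e * e)

/-- Checks by subdivision that the pieces of two words are disjoint. -/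
def separates (D : DiscData) : ℕ → List Bool → List Bool → Bool
  | 0, _, _ => false
  | n + 1, u, v =>
    let s := D.radius u.length + D.radius v.length
    bif decide (s * s < sqDist (D.centre u) (D.centre v)) then true
    else bif Nat.ble u.length v.length then
      D.separates n (u ++ [false]) v && D.separates n (u ++ [true]) v
    else D.separates n u (v ++ [false]) && D.separates n u (v ++ [true])

/-- Checks that the four pairs of pieces away from the double point are disjoint. -/
def isGood (D : DiscData) : Bool :=
  D.isValid && D.separates 30 [false, false] [true] &&
  D.separates 30 [false, true] [true, false] &&
  D.separates 30 [false, true, true] [true, true] &&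
  D.separates 30 [false, true] [true, true, true]

end DiscData

/-- A rational point as a complex number. -/
def ratPoint (p : ℚ × ℚ) : ℂ := ⟨p.1, p.2⟩

/-- The multiplier `(1 - i t) / 2`. -/
def slopeMul (t : ℝ) : ℂ := ⟨1 / 2, -t / 2⟩

theorem letter_ratPoint (t : ℚ) (b : Bool) (p : ℚ × ℚ) :
    letter (slopeMul t) b (ratPoint p) = ratPoint (ratLetter t b p) := by
  cases b <;> apply Complex.ext <;> simp [letter, ratPoint, slopeMul, ratLetter] <;> ring

theorem norm_ratPoint_sub_sq (p q : ℚ × ℚ) :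
    ‖ratPoint p - ratPoint q‖ ^ 2 = (sqDist p q : ℝ) := by
  rw [← Complex.normSq_eq_norm_sq, Complex.normSq_apply]
  simp [ratPoint, sqDist]

theorem norm_slopeMul_sq (t : ℝ) : ‖slopeMul t‖ ^ 2 = (t ^ 2 + 1) / 4 := by
  rw [← Complex.normSq_eq_norm_sq, Complex.normSq_apply]
  simp [slopeMul]; ring

theorem norm_slopeMul_sub (s t : ℝ) : ‖slopeMul s - slopeMul t‖ = |s - t| / 2 := by
  have : slopeMul s - slopeMul t = ((-(s - t) / 2 : ℝ) : ℂ) * Complex.I := by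
    apply Complex.ext <;> simp [slopeMul]; ring
  rw [this, norm_mul, Complex.norm_I, mul_one, Complex.norm_real, Real.norm_eq_abs, abs_div,
    abs_neg]
  norm_num

namespace DiscData

variable {D : DiscData} {t : ℝ} {K : Set ℂ}

theorem isValid_iff : D.isValid = true ↔ 0 ≤ D.t ∧ 0 ≤ D.δ ∧ 0 ≤ D.ρ ∧ D.ρ < 1 ∧ 0 ≤ D.r ∧
    (D.t + D.δ) * (D.t + D.δ) + 1 ≤ 4 * (D.ρ * D.ρ) ∧ 0 ≤ D.m ∧
    D.x * D.x + D.y * D.y ≤ D.m * D.m ∧ 0 ≤ (1 - D.ρ) * D.r - D.δ / 2 * D.m ∧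
    ∀ b, sqDist (ratLetter D.t b (D.x, D.y)) (D.x, D.y) ≤
      ((1 - D.ρ) * D.r - D.δ / 2 * D.m) * ((1 - D.ρ) * D.r - D.δ / 2 * D.m) := by
  simp [isValid, Bool.forall_bool, and_assoc]

theorem norm_slopeMul_le (h : D.isValid = true) {s : ℝ} (h0 : 0 ≤ s) (h1 : s ≤ D.t + D.δ) :
    ‖slopeMul s‖ ≤ D.ρ := by
  obtain ⟨-, -, hρ, -, -, h2, -⟩ := isValid_iff.1 h
  have h2 : ((D.t : ℝ) + D.δ) * (D.t + D.δ) + 1 ≤ 4 * (D.ρ * D.ρ) := by exact_mod_cast h2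
  refine le_of_sq_le_sq ?_ (by exact_mod_cast hρ)
  rw [norm_slopeMul_sq]
  nlinarith

theorem norm_sub_centre_le (h : D.isValid = true) (h0 : 0 ≤ t) (ht : |t - D.t| ≤ D.δ)
    (hK : IsAttractor (letter (slopeMul t) false) (letter (slopeMul t) true) K)
    {z : ℂ} (hz : z ∈ K) : ‖z - ratPoint (D.x, D.y)‖ ≤ D.r := by
  have h1 : t ≤ D.t + D.δ := by linarith [(abs_le.1 ht).2]
  have ha := norm_slopeMul_le h h0 h1
  obtain ⟨-, hδ, -, hρ, -, -, hm, hxy, he, hb⟩ := isValid_iff.1 h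
  refine norm_sub_le_of_mem hK ha (by exact_mod_cast hρ) (fun b => ?_) hz
  have h2 := norm_letter_sub_param (slopeMul t) (slopeMul D.t) b (ratPoint (D.x, D.y))
  rw [norm_slopeMul_sub] at h2
  have h3 : ‖ratPoint (D.x, D.y)‖ ≤ D.m := by
    refine le_of_sq_le_sq ?_ (by exact_mod_cast hm)
    rw [← Complex.normSq_eq_norm_sq, Complex.normSq_apply, sq]
    simp only [ratPoint]
    exact_mod_cast hxy
  have h4 : ‖letter (slopeMul D.t) b (ratPoint (D.x, D.y)) - ratPoint (D.x, D.y)‖ ≤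
      (((1 - D.ρ) * D.r - D.δ / 2 * D.m : ℚ) : ℝ) := by
    refine le_of_sq_le_sq ?_ (by exact_mod_cast he)
    rw [letter_ratPoint, norm_ratPoint_sub_sq, sq]
    exact_mod_cast hb b
  push_cast at h4
  have h5 : |t - D.t| / 2 * ‖ratPoint (D.x, D.y)‖ ≤ D.δ / 2 * D.m := by
    have : (0 : ℝ) ≤ D.δ := by exact_mod_cast hδ
    gcongr
  have h6 := norm_sub_le_norm_sub_add_norm_sub (letter (slopeMul t) b (ratPoint (D.x, D.y)))
    (letter (slopeMul D.t) b (ratPoint (D.x, D.y))) (ratPoint (D.x, D.y))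
  linarith

/-- Each letter scales the error by at most `ρ` and, because the centre is computed with the middle
slope, adds at most `δ / 2 * (m + r)`. This added error does not shrink with the word length, so the
slope intervals must be short. -/
theorem norm_word_sub_centre_le (h : D.isValid = true) (h0 : 0 ≤ t) (ht : |t - D.t| ≤ D.δ)
    (hK : IsAttractor (letter (slopeMul t) false) (letter (slopeMul t) true) K)
    (u : List Bool) {z : ℂ} (hz : z ∈ K) :
    ‖word (slopeMul t) u z - ratPoint (D.centre u)‖ ≤ D.radius u.length := by
  obtain ⟨ht0, hδ, hρ, -, -, -, hm, hxy, -, -⟩ := isValid_iff.1 h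
  induction u with
  | nil => exact norm_sub_centre_le h h0 ht hK hz
  | cons b u ih =>
    have hw := norm_sub_centre_le h h0 ht hK (word_mem hK u hz)
    have h3 : ‖ratPoint (D.x, D.y)‖ ≤ D.m := by
      refine le_of_sq_le_sq ?_ (by exact_mod_cast hm)
      rw [← Complex.normSq_eq_norm_sq, Complex.normSq_apply, sq]
      simp only [ratPoint]
      exact_mod_cast hxy
    have h4 : ‖word (slopeMul t) u z‖ ≤ D.m + D.r := by
      have := norm_le_norm_sub_add (word (slopeMul t) u z) (ratPoint (D.x, D.y))
      linarith
    have h5 := norm_sub_le_norm_sub_add_norm_sub (letter (slopeMul t) b (word (slopeMul t) u z))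
      (letter (slopeMul D.t) b (word (slopeMul t) u z))
      (letter (slopeMul D.t) b (ratPoint (D.centre u)))
    rw [norm_letter_sub, norm_letter_sub_param, norm_slopeMul_sub, letter_ratPoint] at h5
    have h6 : ‖slopeMul D.t‖ ≤ D.ρ := norm_slopeMul_le h (by exact_mod_cast ht0) (by
      have : (0 : ℝ) ≤ D.δ := by exact_mod_cast hδ
      linarith)
    have h7 : |t - D.t| / 2 * ‖word (slopeMul t) u z‖ ≤ D.δ / 2 * (D.m + D.r) := by
      have : (0 : ℝ) ≤ D.δ := by exact_mod_cast hδ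
      gcongr
    have h8 : ‖slopeMul D.t‖ * ‖word (slopeMul t) u z - ratPoint (D.centre u)‖ ≤
        D.ρ * D.radius u.length := by
      have : (0 : ℝ) ≤ D.ρ := by exact_mod_cast hρ
      gcongr
    refine h5.trans ?_
    rw [List.length_cons, radius]
    push_cast
    linarith

/-- Pieces in disjoint discs are disjoint; otherwise a piece is the union of its two subpieces, so a
common point survives in one branch of the subdivision. -/
theorem word_ne_of_separates (h : D.isValid = true) (h0 : 0 ≤ t) (ht : |t - D.t| ≤ D.δ)
    (hK : IsAttractor (letter (slopeMul t) false) (letter (slopeMul t) true) K) (n : ℕ) :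
    ∀ u v : List Bool, D.separates n u v = true → ∀ z ∈ K, ∀ w ∈ K,
      word (slopeMul t) u z ≠ word (slopeMul t) v w := by
  induction n with
  | zero => simp [separates]
  | succ n ih =>
    intro u v hs z hz w hw heq
    rw [separates] at hs
    simp only [Bool.cond_eq_ite, decide_eq_true_eq] at hs
    split_ifs at hs with h1 h2
    · have hu := norm_word_sub_centre_le h h0 ht hK u hz
      have hv := norm_word_sub_centre_le h h0 ht hK v hw
      rw [← heq] at hv
      have h3 : ‖ratPoint (D.centre u) - ratPoint (D.centre v)‖ ≤
          D.radius u.length + D.radius v.length := by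
        have := norm_sub_le_norm_sub_add_norm_sub (ratPoint (D.centre u))
          (word (slopeMul t) u z) (ratPoint (D.centre v))
        rw [norm_sub_rev] at hu
        linarith
      have h4 := norm_ratPoint_sub_sq (D.centre u) (D.centre v)
      have h5 : ((D.radius u.length : ℝ) + D.radius v.length) *
          (D.radius u.length + D.radius v.length) < sqDist (D.centre u) (D.centre v) := by
        exact_mod_cast h1
      have := norm_nonneg (ratPoint (D.centre u) - ratPoint (D.centre v))
      nlinarith
    · obtain ⟨b, y, hy, rfl⟩ := exists_letter hK hz
      rw [← word_append_letter] at heq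
      rw [Bool.and_eq_true] at hs
      cases b
      exacts [ih _ _ hs.1 y hy w hw heq, ih _ _ hs.2 y hy w hw heq]
    · obtain ⟨b, y, hy, rfl⟩ := exists_letter hK hw
      rw [← word_append_letter] at heq
      rw [Bool.and_eq_true] at hs
      cases b
      exacts [ih _ _ hs.1 z hz y hy heq, ih _ _ hs.2 z hz y hy heq]

end DiscData

/-- Discs for a partition of the slope interval `[0, 0.86]`. -/
def discs : List DiscData :=
  [⟨3/50, 3/50, 1/2, 0, 1/2, 101/200, 27/50⟩,
   ⟨9/50, 3/50, 1/2, 0, 1/2, 103/200, 111/200⟩,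
   ⟨119/400, 23/400, 1/2, 0, 1/2, 107/200, 119/200⟩,
   ⟨41/100, 11/200, 1/2, 0, 1/2, 111/200, 16/25⟩,
   ⟨207/400, 21/400, 1/2, 0, 1/2, 29/50, 141/200⟩,
   ⟨49/80, 17/400, 9/20, -3/20, 1/2, 3/5, 19/25⟩,
   ⟨11/16, 13/400, 9/20, -3/20, 1/2, 31/50, 39/50⟩,
   ⟨297/400, 9/400, 9/20, -1/10, 1/2, 63/100, 159/200⟩,
   ⟨313/400, 7/400, 9/20, -1/10, 1/2, 129/200, 21/25⟩,
   ⟨13/16, 1/80, 9/20, -1/10, 1/2, 13/20, 43/50⟩,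
   ⟨167/200, 1/100, 9/20, -1/10, 1/2, 131/200, 22/25⟩,
   ⟨341/400, 3/400, 9/20, -1/10, 1/2, 33/50, 9/10⟩]

theorem isGood_of_mem_discs : discs.all DiscData.isGood = true := by
  decide +kernel

theorem exists_mem_discs {t : ℝ} (h0 : 0 ≤ t) (h1 : t ≤ 0.86) :
    ∃ D ∈ discs, |t - D.t| ≤ D.δ := by
  -- The intervals `[t - δ, t + δ]` abut one another from `0` to `0.86`.
  by_contra! h
  simp only [discs, List.forall_mem_cons, lt_abs] at h
  push_cast at h
  norm_num at h h1
  grind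

end Dragon
end

/-! ### The double point and the arcs -/

noncomputable section

namespace Dragon

/-- At the double point the two branches are images of each other under a rotation about the fixed
point of `letter a false`; they meet only there. -/
theorem eq_zero_of_word_eq {a : ℂ} {K : Set ℂ} (ha0 : a ≠ 0) (ha : ‖a‖ < 1)
    (has : a + starRingEnd ℂ a = 1) (hK : IsAttractor (letter a false) (letter a true) K)
    (h₁ : ∀ z ∈ K, ∀ w ∈ K, word a [false, true, true] z ≠ word a [true, true] w)
    (h₂ : ∀ z ∈ K, ∀ w ∈ K, word a [false, true] z ≠ word a [true, true, true] w)
    {z w : ℂ} (hz : z ∈ K) (hw : w ∈ K) (h : word a [false, true] z = word a [true, true] w) :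
    z = 0 ∧ w = 0 := by
  have hac : starRingEnd ℂ a ≠ 0 := (map_ne_zero _).2 ha0
  have hrel : ∀ z w, word a [false, true] z = word a [true, true] w ↔
      a * z + starRingEnd ℂ a * w = 0 := by
    intro z w
    have : word a [false, true] z - word a [true, true] w =
        -(starRingEnd ℂ a) * (a * z + starRingEnd ℂ a * w) := by
      simp only [word, letter, List.foldr]
      linear_combination has
    rw [← sub_eq_zero, this, mul_eq_zero, or_iff_right (neg_ne_zero.2 hac)]
  -- The coincidence condition is linear, so it is kept when both points are divided by `a`. The
  -- excluded words force both points to begin with `letter a false`, so this compact set is covered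
  -- by its own image under multiplication by `a`.
  have hc : IsCompact {p : ℂ × ℂ | (p.1 ∈ K ∧ p.2 ∈ K) ∧
      a * p.1 + starRingEnd ℂ a * p.2 = 0} :=
    (hK.1.prod hK.1).inter_right (isClosed_eq (by fun_prop) continuous_const)
  have hlip : LipschitzWith ‖a‖₊ fun p : ℂ × ℂ => a • p := lipschitzWith_smul a
  have := eq_fixed_of_mem (p := 0) (by exact_mod_cast ha) hlip hc ?_ (smul_zero a) (z, w)
    ⟨⟨hz, hw⟩, (hrel z w).1 h⟩
  · exact Prod.mk.inj this
  · rintro ⟨z, w⟩ ⟨⟨hz : z ∈ K, hw : w ∈ K⟩, h⟩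
    obtain ⟨b, z', hz', rfl⟩ := exists_letter hK hz
    obtain ⟨b', w', hw', rfl⟩ := exists_letter hK hw
    cases b
    · cases b'
      · refine ⟨(z', w'), ⟨⟨hz', hw'⟩, mul_left_cancel₀ ha0 ?_⟩, rfl⟩
        simp only [letter] at h ⊢
        linear_combination h
      · exact absurd ((hrel _ _).2 h) (h₂ _ hz w' hw')
    · exact absurd ((hrel _ _).2 h) (h₁ z' hz' _ hw)

/-- The first two hypotheses leave only `[false, true]` against `[true, true]` for a common point of
the halves; the last two isolate the double point inside that pair. -/
theorem isZipper_of_word_ne {a : ℂ} {K : Set ℂ} (ha0 : a ≠ 0) (ha : ‖a‖ < 1)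
    (has : a + starRingEnd ℂ a = 1) (hK : IsAttractor (letter a false) (letter a true) K)
    (h₁ : ∀ z ∈ K, ∀ w ∈ K, word a [false, false] z ≠ word a [true] w)
    (h₂ : ∀ z ∈ K, ∀ w ∈ K, word a [false, true] z ≠ word a [true, false] w)
    (h₃ : ∀ z ∈ K, ∀ w ∈ K, word a [false, true, true] z ≠ word a [true, true] w)
    (h₄ : ∀ z ∈ K, ∀ w ∈ K, word a [false, true] z ≠ word a [true, true, true] w) :
    IsZipper (letter a false) (letter a true) ‖a‖₊ 0 1 K where
  lt_one := by exact_mod_cast ha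
  lip_left := LipschitzWith.of_dist_le_mul fun z w => by
    rw [dist_eq_norm, dist_eq_norm, norm_letter_sub, coe_nnnorm]
  lip_right := LipschitzWith.of_dist_le_mul fun z w => by
    rw [dist_eq_norm, dist_eq_norm, norm_letter_sub, coe_nnnorm]
  inj_left := fun z w h => mul_left_cancel₀ ha0 h
  inj_right := fun z w h =>
    mul_left_cancel₀ (neg_ne_zero.2 ((map_ne_zero _).2 ha0)) (add_right_cancel h)
  ne := zero_ne_one
  left_fixed := by simp [letter]
  right_apply := by simp [letter]
  join := by simp only [letter]; linear_combination has
  attractor := hK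
  eq_of_eq := by
    intro x hx y hy h
    obtain ⟨b, z, hz, rfl⟩ := exists_letter hK hx
    obtain ⟨b', w, hw, rfl⟩ := exists_letter hK hy
    cases b
    · exact absurd h (h₁ z hz _ hy)
    · cases b'
      · exact absurd h (h₂ z hz w hw)
      · obtain ⟨rfl, rfl⟩ := eq_zero_of_word_eq ha0 ha has hK h₃ h₄ hz hw h
        simp [letter]

theorem slopeMul_ne_zero (t : ℝ) : slopeMul t ≠ 0 := fun h => by
  simpa [slopeMul] using congrArg Complex.re h

theorem slopeMul_add_conj (t : ℝ) : slopeMul t + starRingEnd ℂ (slopeMul t) = 1 := by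
  apply Complex.ext
  · simp [slopeMul]; norm_num
  · simp [slopeMul]

theorem isSimpleArc_of_isAttractor {t : ℝ} (h0 : 0 ≤ t) (h1 : t ≤ 0.86) {K : Set ℂ}
    (hK : IsAttractor (letter (slopeMul t) false) (letter (slopeMul t) true) K) :
    IsSimpleArc K := by
  obtain ⟨D, hD, ht⟩ := exists_mem_discs h0 h1
  have hgood := List.all_eq_true.1 isGood_of_mem_discs D hD
  simp only [DiscData.isGood, Bool.and_eq_true] at hgood
  obtain ⟨⟨⟨⟨hv, s₁⟩, s₂⟩, s₃⟩, s₄⟩ := hgood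
  have ha : ‖slopeMul t‖ < 1 := by
    have h2 := norm_slopeMul_sq t
    have h3 : t ^ 2 ≤ 0.86 ^ 2 := by gcongr
    nlinarith [norm_nonneg (slopeMul t)]
  exact (isZipper_of_word_ne (slopeMul_ne_zero t) ha (slopeMul_add_conj t) hK
    (DiscData.word_ne_of_separates hv h0 ht hK _ _ _ s₁)
    (DiscData.word_ne_of_separates hv h0 ht hK _ _ _ s₂)
    (DiscData.word_ne_of_separates hv h0 ht hK _ _ _ s₃)
    (DiscData.word_ne_of_separates hv h0 ht hK _ _ _ s₄)).nonempty_homeomorph isZipper_Icc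

/-- Dividing by `2 cos ξ` normalises the real part of `α` to `1 / 2`, leaving the slope as the only
parameter. -/
theorem alpha_eq_slopeMul {ξ : ℝ} (h : Real.cos ξ ≠ 0) : alpha ξ = slopeMul (Real.tan ξ) := by
  rw [alpha, Complex.exp_mul_I, ← Complex.ofReal_neg, ← Complex.ofReal_cos, ← Complex.ofReal_sin]
  apply Complex.ext
  · rw [Complex.div_ofReal_re]
    simp [slopeMul]
    field_simp
    exact Complex.cos_ofReal_re ξ
  · rw [Complex.div_ofReal_im]
    simp [slopeMul, Real.tan_eq_sin_div_cos]
    field_simp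
    rw [Complex.sin_ofReal_re]

theorem isSimpleArc_limitDragon {ξ : ℝ} (h0 : 0 ≤ ξ) (h1 : ξ < 0.70385774) :
    IsSimpleArc (limitDragon ξ) := by
  have hpi := Real.pi_gt_d2
  -- This bound suffices: `1 - 0.7623² < (0.86 * 0.7623)²`, which gives `tan ξ ≤ 0.86`.
  have hc : 0.7623 < Real.cos ξ := by
    have hb := abs_le.1 (abs_cos_sub_taylor_le (x := 0.70385774) (by norm_num [abs_of_pos]))
    rw [abs_of_pos (by norm_num)] at hb
    have hcos := Real.cos_lt_cos_of_nonneg_of_le_pi h0 (by linarith) h1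
    norm_num at hb hcos ⊢
    linarith [hb.1]
  have hs := Real.sin_nonneg_of_nonneg_of_le_pi h0 (by linarith)
  have hsc := Real.sin_sq_add_cos_sq ξ
  have hK := isAttractor_limitDragon h0 (by linarith)
  have hK : IsAttractor (letter (alpha ξ) false) (letter (alpha ξ) true) (limitDragon ξ) := hK
  rw [alpha_eq_slopeMul (by linarith)] at hK
  refine isSimpleArc_of_isAttractor ?_ ?_ hK
  · rw [Real.tan_eq_sin_div_cos]
    exact div_nonneg hs (by linarith)
  · rw [Real.tan_eq_sin_div_cos, div_le_iff₀ (by linarith)]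
    refine le_of_sq_le_sq ?_ (by linarith)
    nlinarith

theorem degrees_lt_degrees {s t : ℝ} : degrees s < degrees t ↔ s < t := by
  rw [degrees, degrees, div_lt_div_iff_of_pos_right Real.pi_pos]
  constructor <;> intro h <;> linarith

end Dragon
end

/-! ### Assembly of the theorem -/

theorem theorem1 :
    ∃ x₀ ξ₀ : ℝ,
      -- `x₀` is the only root of the polynomial in the interval `(√2, (1 + √5) / 2)`
      (∀ x : ℝ, (Real.sqrt 2 < x ∧ x < (1 + Real.sqrt 5) / 2 ∧
        x ^ 6 - 3 * x ^ 4 + 2 * x ^ 2 - 1 = 0) ↔ x = x₀) ∧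
      |x₀ - 1.5247| ≤ 0.00005 ∧
      ξ₀ = Real.arccos (x₀ / 2) ∧
      |ξ₀ - 0.703858| ≤ 0.0000005 ∧
      (∀ ξ : ℝ, 0 ≤ ξ → ξ < ξ₀ → IsSimpleArc (Dragon.limitDragon ξ)) ∧
      -- the same in terms of the unfolding angle, in degrees
      |Dragon.degrees (Dragon.unfoldingAngle ξ₀) - 99.3438| ≤ 0.00005 ∧
      (∀ ξ : ℝ, 0 ≤ ξ → ξ < Real.pi / 3 →
        Dragon.degrees (Dragon.unfoldingAngle ξ₀) < Dragon.degrees (Dragon.unfoldingAngle ξ) →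
        Dragon.degrees (Dragon.unfoldingAngle ξ) ≤ 180 →
        IsSimpleArc (Dragon.limitDragon ξ)) := by
  obtain ⟨x₀, ⟨hl, hu⟩, hx₀⟩ := existsUnique_root
  obtain ⟨hξl, hξu⟩ := arccos_bounds hl hu
  have harc : ∀ ξ : ℝ, 0 ≤ ξ → ξ < Real.arccos (x₀ / 2) → IsSimpleArc (Dragon.limitDragon ξ) :=
    fun ξ h0 h1 => Dragon.isSimpleArc_limitDragon h0 (h1.trans_le hξu)
  refine ⟨x₀, Real.arccos (x₀ / 2), hx₀, ?_, rfl, ?_, harc, ?_, fun ξ h0 _ h2 _ => harc ξ h0 ?_⟩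
  · rw [abs_le]; constructor <;> linarith
  · rw [abs_le]; constructor <;> linarith
  · have h1 := Real.pi_gt_d20
    have h2 := Real.pi_lt_d20
    rw [Dragon.degrees, Dragon.unfoldingAngle, abs_le, le_sub_iff_add_le, sub_le_iff_le_add,
      le_div_iff₀ Real.pi_pos, div_le_iff₀ Real.pi_pos]
    constructor <;> linarith
  · rw [Dragon.degrees_lt_degrees, Dragon.unfoldingAngle, Dragon.unfoldingAngle] at h2
    linarith
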